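/- Let $U\subset\mathbb R^n$ be open and convex and let $f\colon U\to\mathbb R$ be convex. A sequence $(x_k)_{k\ge 0}$ in $U$ is called a \emph{BFGS sequence} for $f$ if $f$ is differentiable at every $x_k$ with $\nabla f(x_k)\neq 0$, and there are numbers $0<\mu<\nu<1$ and a (symmetric) positive definite $n\times n$ matrix $H_0$ such that, with \[ s_k=x_{k+1}-x_k,\qquad y_k=\nabla f(x_{k+1})-\nabla f(x_k),\qquad V_k=I-\frac{s_ky_k^T}{s_k^Ty_k},\qquad H_{k+1}=V_kH_kV_k^T+\frac{s_ks_k^T}{s_k^Ty_k}, \] the following hold for all $k=0,1,2,\dots$: $H_k\nabla f(x_k)=-t_ks_k$ for some $t_k\ge 0$; $f(x_{k+1})\le f(x_k)+\mu\nabla f(x_k)^Ts_k$; and $\nabla f(x_{k+1})^Ts_k\ge\nu\nabla f(x_k)^Ts_k$. Let $(x_k)$ be a BFGS sequence for $f$ such that the level set $\{x\in U: f(x)\le f(x_0)\}$ is compact (so that $\min f=\min_U f$ exists). Consider the condition (*) for every $\delta>0$ there are a convex open set $U_\delta\subset U$ containing $\{x\in U:f(x)\le f(x_0)\}$ and a $C^2$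 convex function $f_\delta\colon U_\delta\to\mathbb R$ with $f_\delta(x)=f(x)$ for all $x\in U$ with $\min f+\delta\le f(x)\le f(x_0)$. If $f$ is $C^2$ on $U$, then (*) holds. If (*) holds, then $f$ attains its minimum on $U$ and $f(x_k)\to\min f$ as $k\to\infty$. -/

import Mathlib

open Filter Topology Matrix

noncomputable section

namespace BFGS

/-- The BFGS update of an approximate inverse Hessian `H` by a step `s` and a gradient difference
`y`: with `V = I - s yᵀ / (sᵀ y)`, the new matrix is `V H Vᵀ + s sᵀ / (sᵀ y)`. -/
def update {n : ℕ} (H : Matrix (Fin n) (Fin n) ℝ) (s y : EuclideanSpace ℝ (Fin n)) :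
    Matrix (Fin n) (Fin n) ℝ :=
  (1 - (inner ℝ s y)⁻¹ • vecMulVec s.ofLp y.ofLp) * H *
      (1 - (inner ℝ s y)⁻¹ • vecMulVec s.ofLp y.ofLp)ᵀ +
    (inner ℝ s y)⁻¹ • vecMulVec s.ofLp s.ofLp

/-- The matrices `H₀, H₁, H₂, …` generated from `H₀` by the BFGS update along the points `x k`,
with steps `x (k + 1) - x k` and gradient differences `∇f (x (k + 1)) - ∇f (x k)`. -/
def hessInv {n : ℕ} (f : EuclideanSpace ℝ (Fin n) → ℝ) (x : ℕ → EuclideanSpace ℝ (Fin n))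
    (H₀ : Matrix (Fin n) (Fin n) ℝ) : ℕ → Matrix (Fin n) (Fin n) ℝ
  | 0 => H₀
  | k + 1 => update (hessInv f x H₀ k) (x (k + 1) - x k)
      (gradient f (x (k + 1)) - gradient f (x k))

/-- `x` is a BFGS sequence for `f`. The three properties required at every `k` are the
quasi-Newton direction of the step, the Armijo condition and the weak Wolfe condition. -/
def IsBFGSSequence {n : ℕ} (f : EuclideanSpace ℝ (Fin n) → ℝ)
    (x : ℕ → EuclideanSpace ℝ (Fin n)) : Prop :=
  (∀ k, DifferentiableAt ℝ f (x k) ∧ gradient f (x k) ≠ 0) ∧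
  ∃ (μ ν : ℝ) (H₀ : Matrix (Fin n) (Fin n) ℝ), 0 < μ ∧ μ < ν ∧ ν < 1 ∧ H₀.PosDef ∧
    ∀ k,
      (∃ t : ℝ, 0 ≤ t ∧
        hessInv f x H₀ k *ᵥ (gradient f (x k)).ofLp = -(t • (x (k + 1) - x k).ofLp)) ∧
      f (x (k + 1)) ≤ f (x k) + μ * inner ℝ (gradient f (x k)) (x (k + 1) - x k) ∧
      ν * inner ℝ (gradient f (x k)) (x (k + 1) - x k) ≤
        inner ℝ (gradient f (x (k + 1))) (x (k + 1) - x k)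

/-- For every `δ > 0` there are a convex open neighbourhood `Uδ ⊆ U` of the level set
`{x ∈ U | f x ≤ f x₀}` and a `C²` convex function `fδ` on `Uδ` that agrees with `f` at all
points `x ∈ U` with `min f + δ ≤ f x ≤ f x₀`. Here `min f` is written as the infimum of `f`
over `U`. -/
def SmoothConvexAbove {n : ℕ} (U : Set (EuclideanSpace ℝ (Fin n)))
    (f : EuclideanSpace ℝ (Fin n) → ℝ) (x₀ : EuclideanSpace ℝ (Fin n)) : Prop :=
  ∀ δ : ℝ, 0 < δ →
    ∃ (Uδ : Set (EuclideanSpace ℝ (Fin n))) (fδ : EuclideanSpace ℝ (Fin n) → ℝ),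
      IsOpen Uδ ∧ Convex ℝ Uδ ∧ Uδ ⊆ U ∧ {x ∈ U | f x ≤ f x₀} ⊆ Uδ ∧
      ContDiffOn ℝ 2 fδ Uδ ∧ ConvexOn ℝ Uδ fδ ∧
      ∀ x ∈ U, sInf (f '' U) + δ ≤ f x → f x ≤ f x₀ → fδ x = f x

end BFGS

end

/-! If `f` is C², take `Uδ = U` and `fδ = f`. For convergence, the potential tr B - log det B of B =
H⁻¹ is nonnegative on positive definite matrices. Let g be the gradient, and s, y the step and the
gradient difference. The C² convex function of (*) gives ‖y‖² ≤ M sᵀy (`norm_sq_gradient_sub_le`,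
`exists_cocoercivity_bound`). Hence one update raises the potential by at most M - log(‖g‖² sᵀy /
(gᵀs)²) (`potential_update_le`).

If the values stay ε above the minimum, convexity and compactness bound ‖g‖ below by some c > 0.
Armijo decrease forces gᵀs → 0, and Wolfe gives sᵀy ≥ (1-ν)|gᵀs|. The logarithm then tends to
infinity, so the potential eventually drops by at least 1 per step, which is impossible. As the
values decrease, coming close to the minimum once is enough. -/

namespace BFGS

/-! ### Convex functions: first and second order inequalities, cocoercivity. -/

section Convex

variable {E : Type*} [NormedAddCommGroup E] [NormedSpace ℝ E]

/-- The first-order inequality for a convex function. -/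
theorem fderiv_le_sub_of_convexOn {V : Set E} {g : E → ℝ} (hg : ConvexOn ℝ V g) {a b : E}
    (ha : a ∈ V) (hb : b ∈ V) (hd : DifferentiableAt ℝ g a) :
    fderiv ℝ g a (b - a) ≤ g b - g a := by
  have hconv := hg.comp_affineMap (AffineMap.lineMap (k := ℝ) a b)
  have h0 : (0 : ℝ) ∈ (AffineMap.lineMap (k := ℝ) a b) ⁻¹' V := by simpa using ha
  have h1 : (1 : ℝ) ∈ (AffineMap.lineMap (k := ℝ) a b) ⁻¹' V := by simpa using hb
  have hd' : HasFDerivAt g (fderiv ℝ g a) (AffineMap.lineMap (k := ℝ) a b 0) := by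
    simpa using hd.hasFDerivAt
  have hder := hd'.comp_hasDerivAt (0 : ℝ) (AffineMap.hasDerivAt_lineMap (a := a) (b := b))
  simpa [slope_def_field] using hconv.le_slope_of_hasDerivAt h0 h1 one_pos hder

theorem fderiv_sub_nonneg_of_convexOn {V : Set E} {g : E → ℝ} (hg : ConvexOn ℝ V g) {a b : E}
    (ha : a ∈ V) (hb : b ∈ V) (hda : DifferentiableAt ℝ g a) (hdb : DifferentiableAt ℝ g b) :
    0 ≤ (fderiv ℝ g b - fderiv ℝ g a) (b - a) := by
  have h1 := fderiv_le_sub_of_convexOn hg ha hb hda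
  have h2 := fderiv_le_sub_of_convexOn hg hb ha hdb
  rw [← neg_sub b a, map_neg] at h2
  rw [_root_.sub_apply]
  linarith

theorem hasDerivAt_fderiv_lineMap {V : Set E} (hV : IsOpen V) {g : E → ℝ}
    (hg : ContDiffOn ℝ 2 g V) (a w v : E) {t : ℝ} (ht : a + t • w ∈ V) :
    HasDerivAt (fun r : ℝ => fderiv ℝ g (a + r • w) v)
      (fderiv ℝ (fderiv ℝ g) (a + t • w) w v) t := by
  have hc : ContDiffAt ℝ 2 g (a + t • w) := hg.contDiffAt (hV.mem_nhds ht)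
  have h1 : DifferentiableAt ℝ (fderiv ℝ g) (a + t • w) :=
    (hc.fderiv_right (m := 1) (by norm_num)).differentiableAt (by norm_num)
  have hl : HasDerivAt (fun r : ℝ => a + r • w) w t := by
    simpa using ((hasDerivAt_id t).smul_const w).const_add a
  have h2 := h1.hasFDerivAt.comp_hasDerivAt t hl
  simpa using h2.clm_apply (hasDerivAt_const t v)

/-- The gradient is monotone, so the right difference quotients of its `w`-component along `w` are
nonnegative. -/
theorem hessian_nonneg_of_convexOn {V : Set E} (hV : IsOpen V) {g : E → ℝ}
    (hg : ContDiffOn ℝ 2 g V) (hconv : ConvexOn ℝ V g) {z : E} (hz : z ∈ V) (w : E) :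
    0 ≤ fderiv ℝ (fderiv ℝ g) z w w := by
  have hder : HasDerivAt (fun r : ℝ => fderiv ℝ g (z + r • w) w)
      (fderiv ℝ (fderiv ℝ g) z w w) 0 := by
    simpa using hasDerivAt_fderiv_lineMap hV hg z w w (t := 0) (by simpa using hz)
  have hd : ∀ p ∈ V, DifferentiableAt ℝ g p := fun p hp =>
    (hg.contDiffAt (hV.mem_nhds hp)).differentiableAt (by norm_num)
  have hlim := hder.tendsto_slope.mono_left
    (nhdsWithin_mono (0 : ℝ) (fun r (hr : r ∈ Set.Ioi (0 : ℝ)) => ne_of_gt hr))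
  refine ge_of_tendsto hlim ?_
  have hcont : Tendsto (fun r : ℝ => z + r • w) (𝓝[>] 0) (𝓝 z) := by
    have : Continuous (fun r : ℝ => z + r • w) := by fun_prop
    simpa using (this.tendsto 0).mono_left nhdsWithin_le_nhds
  filter_upwards [hcont.eventually (hV.mem_nhds hz), self_mem_nhdsWithin] with r hr hr0
  have hr0' : (0 : ℝ) < r := hr0
  have h := fderiv_sub_nonneg_of_convexOn hconv hz hr (hd z hz) (hd _ hr)
  rw [add_sub_cancel_left, map_smul, smul_eq_mul] at h
  have h' := nonneg_of_mul_nonneg_right h hr0'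
  rw [slope_def_field]
  simp only [zero_smul, add_zero, sub_zero]
  exact div_nonneg (by simpa using h') hr0'.le

end Convex

/-- Cocoercivity of the gradient of a `C²` convex function along a segment on which the second
derivative is bounded. -/
theorem norm_sq_gradient_sub_le {E : Type*} [NormedAddCommGroup E] [InnerProductSpace ℝ E]
    [CompleteSpace E] {V : Set E} (hV : IsOpen V) {g : E → ℝ}
    (hg : ContDiffOn ℝ 2 g V) (hconv : ConvexOn ℝ V g) {M : ℝ} (hM : 0 < M) {a b : E}
    (hab : segment ℝ a b ⊆ V)
    (hbound : ∀ z ∈ segment ℝ a b, ‖fderiv ℝ (fderiv ℝ g) z‖ ≤ M) :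
    ‖gradient g b - gradient g a‖ ^ 2 ≤ M * inner ℝ (gradient g b - gradient g a) (b - a) := by
  set s := b - a with hs
  set y := gradient g b - gradient g a with hy
  -- This `v` maximizes 2⟨y, v⟩ - M‖v‖², with maximum ‖y‖²/M.
  set v := M⁻¹ • y with hv
  have hseg : ∀ t ∈ Set.Icc (0 : ℝ) 1, a + t • s ∈ segment ℝ a b := by
    intro t ht
    rw [segment_eq_image']
    exact ⟨t, ht, rfl⟩
  have hder : ∀ t ∈ Set.Icc (0 : ℝ) 1, HasDerivAt
      (fun r : ℝ => fderiv ℝ g (a + r • s) ((2 : ℝ) • v - s) - r * (M * ‖v‖ ^ 2))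
      (fderiv ℝ (fderiv ℝ g) (a + t • s) s ((2 : ℝ) • v - s) - 1 * (M * ‖v‖ ^ 2)) t := by
    intro t ht
    exact (hasDerivAt_fderiv_lineMap hV hg a s _ (hab (hseg t ht))).sub
      ((hasDerivAt_id t).mul_const _)
  have hnonpos : ∀ t ∈ Set.Icc (0 : ℝ) 1,
      fderiv ℝ (fderiv ℝ g) (a + t • s) s ((2 : ℝ) • v - s) - 1 * (M * ‖v‖ ^ 2) ≤ 0 := by
    intro t ht
    have hz := hab (hseg t ht)
    -- Expanding D²g(s-v, s-v) ≥ 0 gives D²g(s, 2v-s) ≤ D²g(v, v) ≤ M‖v‖². The antitone function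
    -- below integrates this over the segment.
    have hpos := hessian_nonneg_of_convexOn hV hg hconv hz (s - v)
    have hsymm : fderiv ℝ (fderiv ℝ g) (a + t • s) v s =
        fderiv ℝ (fderiv ℝ g) (a + t • s) s v :=
      ((hg.contDiffAt (hV.mem_nhds hz)).isSymmSndFDerivAt (by simp)) v s
    have hvv : fderiv ℝ (fderiv ℝ g) (a + t • s) v v ≤ M * ‖v‖ ^ 2 := by
      calc fderiv ℝ (fderiv ℝ g) (a + t • s) v v
          ≤ ‖fderiv ℝ (fderiv ℝ g) (a + t • s) v v‖ := Real.le_norm_self _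
        _ ≤ ‖fderiv ℝ (fderiv ℝ g) (a + t • s)‖ * ‖v‖ * ‖v‖ :=
          ContinuousLinearMap.le_opNorm₂ _ _ _
        _ ≤ M * ‖v‖ * ‖v‖ := by gcongr; exact hbound _ (hseg t ht)
        _ = M * ‖v‖ ^ 2 := by ring
    simp only [map_sub, map_smul, _root_.sub_apply, smul_eq_mul, hsymm] at hpos ⊢
    linarith
  have hanti : AntitoneOn
      (fun r : ℝ => fderiv ℝ g (a + r • s) ((2 : ℝ) • v - s) - r * (M * ‖v‖ ^ 2))
      (Set.Icc 0 1) := by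
    refine antitoneOn_of_deriv_nonpos (convex_Icc 0 1)
      (fun t ht => (hder t ht).continuousAt.continuousWithinAt)
      (fun t ht => (hder t (interior_subset ht)).differentiableAt.differentiableWithinAt)
      (fun t ht => ?_)
    rw [(hder t (interior_subset ht)).deriv]
    exact hnonpos t (interior_subset ht)
  have h01 := hanti (Set.left_mem_Icc.2 zero_le_one) (Set.right_mem_Icc.2 zero_le_one) zero_le_one
  simp only [one_smul, zero_smul, add_zero, hs, add_sub_cancel, ← inner_gradient_left] at h01
  rw [← hs] at h01
  have hkey : inner ℝ y ((2 : ℝ) • v - s) ≤ M * ‖v‖ ^ 2 := by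
    rw [hy, inner_sub_left]
    linarith
  rw [inner_sub_right, hv, inner_smul_right, inner_smul_right, real_inner_self_eq_norm_sq,
    norm_smul, norm_inv, Real.norm_of_nonneg hM.le] at hkey
  have h2 : M * (M⁻¹ * ‖y‖) ^ 2 = M⁻¹ * ‖y‖ ^ 2 := by field_simp
  rw [h2] at hkey
  have h3 : M⁻¹ * ‖y‖ ^ 2 ≤ inner ℝ y s := by linarith
  calc ‖y‖ ^ 2 = M * (M⁻¹ * ‖y‖ ^ 2) := by field_simp
    _ ≤ _ := by gcongr

variable {n : ℕ}

/-! ### Algebra of the BFGS update: positivity, inverse, trace, determinant. -/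

theorem inner_eq_dotProduct (u v : EuclideanSpace ℝ (Fin n)) :
    inner ℝ u v = u.ofLp ⬝ᵥ v.ofLp := by
  rw [EuclideanSpace.inner_eq_star_dotProduct, star_trivial, dotProduct_comm]

theorem norm_sq_eq_dotProduct (u : EuclideanSpace ℝ (Fin n)) :
    ‖u‖ ^ 2 = u.ofLp ⬝ᵥ u.ofLp := by
  rw [← real_inner_self_eq_norm_sq, inner_eq_dotProduct]

/-- The BFGS update of the approximate Hessian, that is, of the inverse matrix. -/
noncomputable def dualUpdate (B : Matrix (Fin n) (Fin n) ℝ) (s y : Fin n → ℝ) :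
    Matrix (Fin n) (Fin n) ℝ :=
  B - (s ⬝ᵥ B *ᵥ s)⁻¹ • vecMulVec (B *ᵥ s) (B *ᵥ s) + (s ⬝ᵥ y)⁻¹ • vecMulVec y y

theorem update_mulVec (H : Matrix (Fin n) (Fin n) ℝ) (s y : EuclideanSpace ℝ (Fin n))
    (w : Fin n → ℝ) :
    update H s y *ᵥ w =
      (H *ᵥ (w - ((inner ℝ s y)⁻¹ * (s.ofLp ⬝ᵥ w)) • y.ofLp) -
        ((inner ℝ s y)⁻¹ *
          (y.ofLp ⬝ᵥ H *ᵥ (w - ((inner ℝ s y)⁻¹ * (s.ofLp ⬝ᵥ w)) • y.ofLp))) • s.ofLp) +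
      ((inner ℝ s y)⁻¹ * (s.ofLp ⬝ᵥ w)) • s.ofLp := by
  simp only [update, add_mulVec, ← mulVec_mulVec, transpose_sub, transpose_one, transpose_smul,
    transpose_vecMulVec, sub_mulVec, one_mulVec, smul_mulVec, vecMulVec_mulVec, op_smul_eq_smul,
    smul_smul]

/-- Both summands are semidefinite. The rank-one term is positive at `w` unless sᵀw = 0, and then
Vᵀw = w, so the first term is wᵀHw. -/
theorem update_posDef {H : Matrix (Fin n) (Fin n) ℝ} (hH : H.PosDef)
    {s y : EuclideanSpace ℝ (Fin n)} (hsy : 0 < inner ℝ s y) : (update H s y).PosDef := by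
  set V : Matrix (Fin n) (Fin n) ℝ := 1 - (inner ℝ s y)⁻¹ • vecMulVec s.ofLp y.ofLp with hV
  have h1 : (V * H * Vᵀ).PosSemidef := by
    simpa using hH.posSemidef.mul_mul_conjTranspose_same V
  have h2 : ((inner ℝ s y)⁻¹ • vecMulVec s.ofLp s.ofLp).PosSemidef := by
    simpa using (posSemidef_vecMulVec_self_star s.ofLp).smul (inv_nonneg.2 hsy.le)
  refine .of_dotProduct_mulVec_pos (h1.add h2).isHermitian fun w hw => ?_
  have e1 : star w ⬝ᵥ (V * H * Vᵀ) *ᵥ w = (Vᵀ *ᵥ w) ⬝ᵥ H *ᵥ (Vᵀ *ᵥ w) := by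
    rw [star_trivial, ← mulVec_mulVec, ← mulVec_mulVec, dotProduct_mulVec, ← mulVec_transpose]
  have e2 : star w ⬝ᵥ ((inner ℝ s y)⁻¹ • vecMulVec s.ofLp s.ofLp) *ᵥ w =
      (inner ℝ s y)⁻¹ * (s.ofLp ⬝ᵥ w) ^ 2 := by
    rw [star_trivial, smul_mulVec, vecMulVec_mulVec, op_smul_eq_smul, dotProduct_smul,
      dotProduct_smul, dotProduct_comm w, smul_eq_mul, smul_eq_mul, sq]
  change 0 < star w ⬝ᵥ (V * H * Vᵀ + (inner ℝ s y)⁻¹ • vecMulVec s.ofLp s.ofLp) *ᵥ w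
  rw [add_mulVec, dotProduct_add, e1, e2]
  have hpos := inv_pos.2 hsy
  by_cases hs : s.ofLp ⬝ᵥ w = 0
  · have hVw : Vᵀ *ᵥ w = w := by
      simp [hV, sub_mulVec, smul_mulVec, vecMulVec_mulVec, transpose_vecMulVec, hs]
    rw [hVw, hs]
    simpa using hH.dotProduct_mulVec_pos hw
  · have h3 : 0 ≤ (Vᵀ *ᵥ w) ⬝ᵥ H *ᵥ (Vᵀ *ᵥ w) := by
      simpa using hH.posSemidef.dotProduct_mulVec_nonneg (Vᵀ *ᵥ w)
    positivity

theorem dotProduct_mulVec_symm {B : Matrix (Fin n) (Fin n) ℝ} (hB : B.IsHermitian)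
    (u v : Fin n → ℝ) : u ⬝ᵥ B *ᵥ v = (B *ᵥ u) ⬝ᵥ v := by
  rw [dotProduct_mulVec, ← mulVec_transpose, ← conjTranspose_eq_transpose_of_trivial, hB.eq]

theorem update_mul_dualUpdate {H B : Matrix (Fin n) (Fin n) ℝ} (hB : B.IsHermitian)
    (hHB : H * B = 1) {s y : EuclideanSpace ℝ (Fin n)} (hsy : inner ℝ s y ≠ 0)
    (hsB : s.ofLp ⬝ᵥ B *ᵥ s.ofLp ≠ 0) :
    update H s y * dualUpdate B s.ofLp y.ofLp = 1 := by
  have hcancel : ∀ u, H *ᵥ (B *ᵥ u) = u := fun u => by rw [mulVec_mulVec, hHB, one_mulVec]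
  refine ext_of_mulVec_single fun i => ?_
  generalize (Pi.single i 1 : Fin n → ℝ) = v
  rw [one_mulVec, ← mulVec_mulVec]
  set ρ := inner ℝ s y with hρ
  set a := s.ofLp ⬝ᵥ B *ᵥ s.ofLp with ha
  set c := a⁻¹ * ((B *ᵥ s.ofLp) ⬝ᵥ v) with hc
  have hρ' : s.ofLp ⬝ᵥ y.ofLp = ρ := (inner_eq_dotProduct s y).symm
  have hw : dualUpdate B s.ofLp y.ofLp *ᵥ v =
      B *ᵥ v - c • B *ᵥ s.ofLp + (ρ⁻¹ * (y.ofLp ⬝ᵥ v)) • y.ofLp := by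
    simp only [dualUpdate, add_mulVec, sub_mulVec, smul_mulVec, vecMulVec_mulVec, op_smul_eq_smul,
      smul_smul, hρ', ← ha, hc]
  -- The secant equation B₊s = y, in transposed form.
  have hsw : s.ofLp ⬝ᵥ (dualUpdate B s.ofLp y.ofLp *ᵥ v) = y.ofLp ⬝ᵥ v := by
    rw [hw, dotProduct_add, dotProduct_sub, dotProduct_smul, dotProduct_smul, ← ha, hρ',
      dotProduct_mulVec_symm hB, hc]
    simp only [smul_eq_mul]
    field_simp
    ring
  rw [update_mulVec, hsw, hw, ← hρ, add_sub_cancel_right, mulVec_sub, mulVec_smul, hcancel,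
    hcancel, dotProduct_sub, dotProduct_smul, dotProduct_comm y.ofLp s.ofLp, hρ']
  ext j
  simp only [Pi.add_apply, Pi.sub_apply, Pi.smul_apply, smul_eq_mul]
  field_simp
  ring

theorem trace_dualUpdate (B : Matrix (Fin n) (Fin n) ℝ) (s y : Fin n → ℝ) :
    (dualUpdate B s y).trace = B.trace - (s ⬝ᵥ B *ᵥ s)⁻¹ * ((B *ᵥ s) ⬝ᵥ (B *ᵥ s)) +
      (s ⬝ᵥ y)⁻¹ * (y ⬝ᵥ y) := by
  simp [dualUpdate, trace_add, trace_sub, trace_smul, trace_vecMulVec]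

/-- The update is B(1 + PQ) with PQ of rank at most two, so det(1 + PQ) = det(1 + QP) is a 2×2
determinant. Its upper left entry vanishes, which leaves sᵀy / sᵀBs. -/
theorem det_dualUpdate {H B : Matrix (Fin n) (Fin n) ℝ} (hB : B.IsHermitian)
    (hBH : B * H = 1) {s y : Fin n → ℝ} (hsy : s ⬝ᵥ y ≠ 0) (hsB : s ⬝ᵥ B *ᵥ s ≠ 0) :
    (dualUpdate B s y).det = B.det * ((s ⬝ᵥ y) / (s ⬝ᵥ B *ᵥ s)) := by
  set a := s ⬝ᵥ B *ᵥ s with ha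
  set ρ := s ⬝ᵥ y with hρ
  let P : Matrix (Fin n) (Fin 2) ℝ := (Matrix.of ![-a⁻¹ • s, ρ⁻¹ • H *ᵥ y])ᵀ
  let Q : Matrix (Fin 2) (Fin n) ℝ := Matrix.of ![B *ᵥ s, y]
  have hPQ : P * Q = -a⁻¹ • vecMulVec s (B *ᵥ s) + ρ⁻¹ • vecMulVec (H *ᵥ y) y := by
    ext i j
    simp [P, Q, mul_apply, Fin.sum_univ_two, vecMulVec_apply, mul_assoc]
  have hfac : dualUpdate B s y = B * (1 + P * Q) := by
    rw [hPQ, mul_add, mul_add, mul_one, Matrix.mul_smul, Matrix.mul_smul, mul_vecMulVec, mul_vecMulVec,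
      mulVec_mulVec, hBH, one_mulVec, dualUpdate, neg_smul]
    abel
  have hQP : 1 + Q * P = !![0, 1; -(ρ / a), 1 + ρ⁻¹ * (y ⬝ᵥ H *ᵥ y)] := by
    have h00 : (B *ᵥ s) ⬝ᵥ s = a := by rw [dotProduct_comm]
    have h01 : (B *ᵥ s) ⬝ᵥ (H *ᵥ y) = ρ := by
      rw [← dotProduct_mulVec_symm hB, mulVec_mulVec, hBH, one_mulVec]
    have h10 : y ⬝ᵥ s = ρ := dotProduct_comm _ _
    have hentry : ∀ i j, (Q * P) i j =
        ![B *ᵥ s, y] i ⬝ᵥ ![-a⁻¹ • s, ρ⁻¹ • H *ᵥ y] j := fun i j => rfl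
    ext i j
    rw [Matrix.add_apply, hentry]
    fin_cases i <;> fin_cases j <;>
      simp [h00, h01, h10, hsy, hsB, div_eq_inv_mul]
  rw [hfac, det_mul, det_one_add_mul_comm, hQP, det_fin_two_of]
  ring

/-! ### The potential and its change in one step. -/

/-- The Byrd–Nocedal potential `tr H⁻¹ - log det H⁻¹`. -/
noncomputable def potential (H : Matrix (Fin n) (Fin n) ℝ) : ℝ :=
  H⁻¹.trace - Real.log H⁻¹.det

/-- In terms of the eigenvalues λ of H⁻¹ it is the sum of λ - log λ, and each term is at least 1. -/
theorem potential_nonneg {H : Matrix (Fin n) (Fin n) ℝ} (hH : H.PosDef) : 0 ≤ potential H := by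
  have hB := hH.inv
  rw [potential, hB.isHermitian.det_eq_prod_eigenvalues, hB.isHermitian.trace_eq_sum_eigenvalues]
  simp only [RCLike.ofReal_real_eq_id, id_eq]
  rw [Real.log_prod fun i _ => (hB.eigenvalues_pos i).ne', ← Finset.sum_sub_distrib]
  refine Finset.sum_nonneg fun i _ => ?_
  linarith [Real.log_le_sub_one_of_pos (hB.eigenvalues_pos i)]

theorem potential_update {H : Matrix (Fin n) (Fin n) ℝ} (hH : H.PosDef)
    {s y : EuclideanSpace ℝ (Fin n)} (hsy : 0 < inner ℝ s y) :
    potential (update H s y) = potential H -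
      (s.ofLp ⬝ᵥ H⁻¹ *ᵥ s.ofLp)⁻¹ * ((H⁻¹ *ᵥ s.ofLp) ⬝ᵥ (H⁻¹ *ᵥ s.ofLp)) +
      (inner ℝ s y)⁻¹ * ‖y‖ ^ 2 -
      Real.log (inner ℝ s y / (s.ofLp ⬝ᵥ H⁻¹ *ᵥ s.ofLp)) := by
  have hdet : IsUnit H.det := (isUnit_iff_isUnit_det _).1 hH.isUnit
  have hs : s.ofLp ≠ 0 := by
    intro h
    rw [inner_eq_dotProduct, h, zero_dotProduct] at hsy
    exact hsy.false
  have ha : 0 < s.ofLp ⬝ᵥ H⁻¹ *ᵥ s.ofLp := by simpa using hH.inv.dotProduct_mulVec_pos hs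
  have hinv : (update H s y)⁻¹ = dualUpdate H⁻¹ s.ofLp y.ofLp :=
    inv_eq_right_inv (update_mul_dualUpdate hH.inv.isHermitian (mul_nonsing_inv _ hdet) hsy.ne'
      ha.ne')
  have hsy' : s.ofLp ⬝ᵥ y.ofLp ≠ 0 := by rw [← inner_eq_dotProduct]; exact hsy.ne'
  rw [potential, hinv, trace_dualUpdate, det_dualUpdate hH.inv.isHermitian
    (nonsing_inv_mul _ hdet) hsy' ha.ne', Real.log_mul hH.inv.det_pos.ne'
    (div_ne_zero hsy' ha.ne'), potential, norm_sq_eq_dotProduct, inner_eq_dotProduct]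
  ring

/-- One quasi-Newton step with `‖y‖² ≤ M sᵀy` changes the potential in a controlled way. -/
theorem potential_update_le {H : Matrix (Fin n) (Fin n) ℝ} (hH : H.PosDef)
    {s y g : EuclideanSpace ℝ (Fin n)} (hsy : 0 < inner ℝ s y) {M t : ℝ} (ht : 0 < t)
    (hg : g ≠ 0) (hstep : H *ᵥ g.ofLp = -(t • s.ofLp)) (hM : ‖y‖ ^ 2 ≤ M * inner ℝ s y) :
    potential (update H s y) ≤ potential H + M -
      Real.log (‖g‖ ^ 2 * inner ℝ s y / (inner ℝ g s) ^ 2) := by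
  have hdet : IsUnit H.det := (isUnit_iff_isUnit_det _).1 hH.isUnit
  have hBs : H⁻¹ *ᵥ s.ofLp = -(t⁻¹ • g.ofLp) := by
    have h1 : s.ofLp = -(t⁻¹ • H *ᵥ g.ofLp) := by
      rw [hstep, smul_neg, neg_neg, smul_smul, inv_mul_cancel₀ ht.ne', one_smul]
    rw [h1, mulVec_neg, mulVec_smul, mulVec_mulVec, nonsing_inv_mul _ hdet, one_mulVec]
  have hs : s.ofLp ≠ 0 := by
    intro h
    rw [inner_eq_dotProduct, h, zero_dotProduct] at hsy
    exact hsy.false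
  have ha : 0 < s.ofLp ⬝ᵥ H⁻¹ *ᵥ s.ofLp := by simpa using hH.inv.dotProduct_mulVec_pos hs
  have hgn : 0 < ‖g‖ := norm_pos_iff.2 hg
  have ha' : s.ofLp ⬝ᵥ H⁻¹ *ᵥ s.ofLp = t⁻¹ * -inner ℝ g s := by
    rw [hBs, dotProduct_neg, dotProduct_smul, dotProduct_comm, ← inner_eq_dotProduct, smul_eq_mul]
    ring
  have hgs : 0 < -inner ℝ g s := by
    rw [ha'] at ha
    exact pos_of_mul_pos_right ha (inv_nonneg.2 ht.le)
  have hb : (H⁻¹ *ᵥ s.ofLp) ⬝ᵥ (H⁻¹ *ᵥ s.ofLp) = t⁻¹ ^ 2 * ‖g‖ ^ 2 := by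
    rw [hBs, neg_dotProduct_neg, smul_dotProduct, dotProduct_smul, norm_sq_eq_dotProduct]
    simp only [smul_eq_mul]
    ring
  rw [potential_update hH hsy, ha', hb]
  set σ := -inner ℝ g s with hσ
  have hy : (inner ℝ s y)⁻¹ * ‖y‖ ^ 2 ≤ M := by
    rw [inv_mul_le_iff₀ hsy]
    linarith
  have hq : 0 < (t⁻¹ * σ)⁻¹ * (t⁻¹ ^ 2 * ‖g‖ ^ 2) := by positivity
  have hr : 0 < inner ℝ s y / (t⁻¹ * σ) := by positivity
  have hlog := Real.log_le_sub_one_of_pos hq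
  -- With q = ‖Bs‖²/(sᵀBs), the ratio is q · (sᵀy / sᵀBs) and the unknown factor `t` cancels. The
  -- trace term -q pays for log q, since log q - q ≤ -1.
  have hprod : ‖g‖ ^ 2 * inner ℝ s y / (inner ℝ g s) ^ 2 =
      ((t⁻¹ * σ)⁻¹ * (t⁻¹ ^ 2 * ‖g‖ ^ 2)) * (inner ℝ s y / (t⁻¹ * σ)) := by
    have : (inner ℝ g s) ^ 2 = σ ^ 2 := by rw [hσ]; ring
    rw [this]
    field_simp
  rw [hprod, Real.log_mul hq.ne' hr.ne']
  linarith

/-! ### Descent and curvature from the step conditions. -/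

theorem inner_neg_of_step {H : Matrix (Fin n) (Fin n) ℝ} (hH : H.PosDef)
    {g s : EuclideanSpace ℝ (Fin n)} (hg : g ≠ 0) {t : ℝ} (ht : 0 ≤ t)
    (hstep : H *ᵥ g.ofLp = -(t • s.ofLp)) : 0 < t ∧ inner ℝ g s < 0 := by
  have hg' : g.ofLp ≠ 0 := fun h => hg (by ext i; simp [h])
  have hpos : 0 < g.ofLp ⬝ᵥ H *ᵥ g.ofLp := by simpa using hH.dotProduct_mulVec_pos hg'
  rw [hstep, dotProduct_neg, dotProduct_smul, ← inner_eq_dotProduct, smul_eq_mul] at hpos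
  have ht' : 0 < t := ht.lt_of_ne (by rintro rfl; simp at hpos)
  exact ⟨ht', by nlinarith⟩

theorem curvature_of_wolfe {ν : ℝ} {g g' s : EuclideanSpace ℝ (Fin n)}
    (hwolfe : ν * inner ℝ g s ≤ inner ℝ g' s) :
    (1 - ν) * -inner ℝ g s ≤ inner ℝ s (g' - g) := by
  rw [inner_sub_right, real_inner_comm g' s, real_inner_comm g s]
  linarith

/-- The matrices of a BFGS iteration that satisfies the weak Wolfe condition are positive
definite. -/
theorem hessInv_posDef {f : EuclideanSpace ℝ (Fin n) → ℝ} {x : ℕ → EuclideanSpace ℝ (Fin n)}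
    {H₀ : Matrix (Fin n) (Fin n) ℝ} {ν : ℝ} (hν : ν < 1) (hH₀ : H₀.PosDef)
    (hg : ∀ k, gradient f (x k) ≠ 0)
    (hstep : ∀ k, ∃ t : ℝ, 0 ≤ t ∧
      hessInv f x H₀ k *ᵥ (gradient f (x k)).ofLp = -(t • (x (k + 1) - x k).ofLp))
    (hwolfe : ∀ k, ν * inner ℝ (gradient f (x k)) (x (k + 1) - x k) ≤
      inner ℝ (gradient f (x (k + 1))) (x (k + 1) - x k)) (k : ℕ) :
    (hessInv f x H₀ k).PosDef := by
  induction k with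
  | zero => exact hH₀
  | succ k ih =>
    obtain ⟨t, ht, hst⟩ := hstep k
    have hneg := (inner_neg_of_step ih (hg k) ht hst).2
    refine update_posDef ih (lt_of_lt_of_le ?_ (curvature_of_wolfe (hwolfe k)))
    exact mul_pos (by linarith) (by linarith)

/-! ### Compact level sets and convergence of the values. -/

theorem exists_isMinOn_of_isCompact_sublevel {E : Type*} [TopologicalSpace E] {U : Set E}
    {f : E → ℝ} (hf : ContinuousOn f U) {x₀ : E} (hx₀ : x₀ ∈ U)
    (hlev : IsCompact {z ∈ U | f z ≤ f x₀}) : ∃ z ∈ U, ∀ w ∈ U, f z ≤ f w := by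
  obtain ⟨z, hz, hmin⟩ := hlev.exists_isMinOn ⟨x₀, hx₀, le_rfl⟩
    (hf.mono fun w hw => hw.1)
  refine ⟨z, hz.1, fun w hw => ?_⟩
  rcases le_total (f w) (f x₀) with h | h
  · exact hmin ⟨hw, h⟩
  · exact hz.2.trans h

/-- The gradients of `f` along points strictly between two levels are cocoercive when `f` agrees
between these levels with a `C²` convex function. -/
theorem exists_cocoercivity_bound {U : Set (EuclideanSpace ℝ (Fin n))} (hUo : IsOpen U)
    {f : EuclideanSpace ℝ (Fin n) → ℝ} (hf : ConvexOn ℝ U f) {x₀ : EuclideanSpace ℝ (Fin n)}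
    (hlev : IsCompact {z ∈ U | f z ≤ f x₀}) (hsm : SmoothConvexAbove U f x₀) {δ : ℝ}
    (hδ : 0 < δ) :
    ∃ M : ℝ, ∀ a ∈ U, ∀ b ∈ U, sInf (f '' U) + δ < f a → f a < f x₀ →
      sInf (f '' U) + δ < f b → f b < f x₀ →
      ‖gradient f b - gradient f a‖ ^ 2 ≤
        M * inner ℝ (b - a) (gradient f b - gradient f a) := by
  obtain ⟨V, g, hVo, -, -, hLV, hg2, hgc, hgf⟩ := hsm δ hδ
  have hfc := hf.continuousOn hUo
  have hcont : ContinuousOn (fun z => ‖fderiv ℝ (fderiv ℝ g) z‖) V := by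
    have h1 : ContDiffOn ℝ 1 (fderiv ℝ g) V := hg2.fderiv_of_isOpen hVo (by norm_num)
    exact (h1.continuousOn_fderiv_of_isOpen hVo (by norm_num)).norm
  obtain ⟨C, hC⟩ := hlev.bddAbove_image (hcont.mono hLV)
  -- Strict inequalities make `f` and `g` agree near `a`, so their gradients coincide there.
  have hgrad : ∀ a ∈ U, sInf (f '' U) + δ < f a → f a < f x₀ → gradient f a = gradient g a := by
    intro a ha h1 h2
    have hca := hfc.continuousAt (hUo.mem_nhds ha)
    have heq : f =ᶠ[𝓝 a] g := by
      filter_upwards [hUo.mem_nhds ha, hca.eventually (lt_mem_nhds h1),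
        hca.eventually (gt_mem_nhds h2)] with z hz hz1 hz2
      exact (hgf z hz hz1.le hz2.le).symm
    rw [gradient, gradient, heq.fderiv_eq]
  refine ⟨max C 1, fun a ha b hb ha1 ha2 hb1 hb2 => ?_⟩
  -- The segment may dip below the lower level, where `g` can differ from `f`. It stays in the level
  -- set, on which the Hessian bound `C` for `g` holds.
  have hseg : segment ℝ a b ⊆ {z ∈ U | f z ≤ f x₀} :=
    (hf.convex_le (f x₀)).segment_subset ⟨ha, ha2.le⟩ ⟨hb, hb2.le⟩
  rw [hgrad a ha ha1 ha2, hgrad b hb hb1 hb2, real_inner_comm]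
  exact norm_sq_gradient_sub_le hVo hg2 hgc (lt_max_of_lt_right one_pos) (hseg.trans hLV)
    fun z hz => le_max_of_le_left (hC ⟨z, hseg hz, rfl⟩)

/-- The values of `f` along a BFGS sequence come arbitrarily close to the infimum. -/
theorem exists_lt_of_isBFGSSequence {U : Set (EuclideanSpace ℝ (Fin n))} (hUo : IsOpen U)
    {f : EuclideanSpace ℝ (Fin n) → ℝ} (hf : ConvexOn ℝ U f)
    {x : ℕ → EuclideanSpace ℝ (Fin n)} (hxU : ∀ k, x k ∈ U)
    (hd : ∀ k, DifferentiableAt ℝ f (x k)) (hg0 : ∀ k, gradient f (x k) ≠ 0)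
    (hlev : IsCompact {z ∈ U | f z ≤ f (x 0)}) (hsm : SmoothConvexAbove U f (x 0))
    {μ ν : ℝ} {H₀ : Matrix (Fin n) (Fin n) ℝ} (hμ : 0 < μ) (hν : ν < 1)
    (hpd : ∀ k, (hessInv f x H₀ k).PosDef)
    (hstep : ∀ k, ∃ t : ℝ, 0 < t ∧
      hessInv f x H₀ k *ᵥ (gradient f (x k)).ofLp = -(t • (x (k + 1) - x k).ofLp))
    (hneg : ∀ k, inner ℝ (gradient f (x k)) (x (k + 1) - x k) < 0)
    (harmijo : ∀ k,
      f (x (k + 1)) ≤ f (x k) + μ * inner ℝ (gradient f (x k)) (x (k + 1) - x k))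
    (hwolfe : ∀ k, ν * inner ℝ (gradient f (x k)) (x (k + 1) - x k) ≤
      inner ℝ (gradient f (x (k + 1))) (x (k + 1) - x k)) {ε : ℝ} (hε : 0 < ε) :
    ∃ k, f (x k) < sInf (f '' U) + ε := by
  by_contra! hfar
  obtain ⟨z, hzU, hzmin⟩ :=
    exists_isMinOn_of_isCompact_sublevel (hf.continuousOn hUo) (hxU 0) hlev
  have hz : sInf (f '' U) = f z :=
    IsLeast.csInf_eq ⟨⟨z, hzU, rfl⟩, by rintro _ ⟨w, hw, rfl⟩; exact hzmin w hw⟩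
  have hanti : StrictAnti fun k => f (x k) :=
    strictAnti_nat_of_succ_lt fun k => by nlinarith [harmijo k, hneg k]
  have hle : ∀ k, f (x k) ≤ f (x 0) := fun k => hanti.antitone (Nat.zero_le k)
  -- the gradients are bounded away from zero
  obtain ⟨c, hc, hcg⟩ : ∃ c > 0, ∀ k, c ≤ ‖gradient f (x k)‖ := by
    obtain ⟨D, hD⟩ := hlev.isBounded.subset_closedBall z
    have hD0 : 0 ≤ D := dist_nonneg.trans (hD ⟨hxU 0, le_rfl⟩)
    refine ⟨ε / (D + 1), by positivity, fun k => ?_⟩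
    rw [div_le_iff₀ (by positivity)]
    have h1 := fderiv_le_sub_of_convexOn hf (hxU k) hzU (hd k)
    rw [← inner_gradient_left] at h1
    have h2 := abs_real_inner_le_norm (gradient f (x k)) (z - x k)
    have h3 : ‖z - x k‖ ≤ D + 1 := by
      have : dist (x k) z ≤ D := hD ⟨hxU k, hle k⟩
      rw [← dist_eq_norm, dist_comm]
      linarith
    calc ε ≤ f (x k) - f z := by linarith [hfar k]
      _ ≤ |inner ℝ (gradient f (x k)) (z - x k)| := by
        linarith [neg_abs_le (inner ℝ (gradient f (x k)) (z - x k))]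
      _ ≤ ‖gradient f (x k)‖ * ‖z - x k‖ := h2
      _ ≤ _ := by gcongr
  -- the directional derivatives tend to zero
  have hlim : Tendsto (fun k => -inner ℝ (gradient f (x k)) (x (k + 1) - x k)) atTop (𝓝 0) := by
    have hbdd : BddBelow (Set.range fun k => f (x k)) :=
      ⟨f z, by rintro _ ⟨k, rfl⟩; exact hzmin _ (hxU k)⟩
    have h1 := tendsto_atTop_ciInf hanti.antitone hbdd
    have h2 := (h1.sub (h1.comp (tendsto_add_atTop_nat 1))).const_mul μ⁻¹
    rw [sub_self, mul_zero] at h2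
    refine squeeze_zero (fun k => by linarith [hneg k]) (fun k => ?_) h2
    rw [Function.comp_apply, le_inv_mul_iff₀ hμ]
    linarith [harmijo k]
  -- Half of `ε` puts all iterates strictly above the lower level.
  obtain ⟨M, hM⟩ := exists_cocoercivity_bound hUo hf hlev hsm (half_pos hε)
  have hν' : 0 < 1 - ν := by linarith
  -- Once σ = -gᵀs is below this threshold, (1-ν)c²/σ exceeds exp(M+1), so the logarithm beats M by
  -- 1.
  have hη : 0 < (1 - ν) * c ^ 2 / Real.exp (M + 1) := by positivity
  obtain ⟨N, hN⟩ := eventually_atTop.1 (hlim.eventually (gt_mem_nhds hη))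
  -- Starting at N + 1 ensures k > 0, hence f(x k) < f(x 0) strictly.
  have hdecr : ∀ k, N + 1 ≤ k →
      potential (hessInv f x H₀ (k + 1)) ≤ potential (hessInv f x H₀ k) - 1 := by
    intro k hk
    obtain ⟨t, ht, hst⟩ := hstep k
    have hcurv := curvature_of_wolfe (hwolfe k)
    have hσ : 0 < -inner ℝ (gradient f (x k)) (x (k + 1) - x k) := by linarith [hneg k]
    have hsy : 0 < inner ℝ (x (k + 1) - x k) (gradient f (x (k + 1)) - gradient f (x k)) :=
      (mul_pos hν' hσ).trans_le hcurv
    have hcoc := hM (x k) (hxU k) (x (k + 1)) (hxU _) (by linarith [hfar k])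
      (hanti (by omega : 0 < k)) (by linarith [hfar (k + 1)]) (hanti (Nat.succ_pos k))
    have hpot := potential_update_le (hpd k) hsy ht (hg0 k) hst hcoc
    have hsmall := hN k (by omega)
    set σ := -inner ℝ (gradient f (x k)) (x (k + 1) - x k) with hσdef
    have hlog : M + 1 ≤ Real.log (‖gradient f (x k)‖ ^ 2 *
        inner ℝ (x (k + 1) - x k) (gradient f (x (k + 1)) - gradient f (x k)) /
        (inner ℝ (gradient f (x k)) (x (k + 1) - x k)) ^ 2) := by
      have hsq : (inner ℝ (gradient f (x k)) (x (k + 1) - x k)) ^ 2 = σ ^ 2 := by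
        rw [hσdef, neg_sq]
      rw [hsq]
      have hexp : Real.exp (M + 1) ≤ ‖gradient f (x k)‖ ^ 2 *
          inner ℝ (x (k + 1) - x k) (gradient f (x (k + 1)) - gradient f (x k)) / σ ^ 2 := by
        rw [lt_div_iff₀ (Real.exp_pos _)] at hsmall
        rw [le_div_iff₀ (by positivity)]
        calc Real.exp (M + 1) * σ ^ 2 = σ * Real.exp (M + 1) * σ := by ring
          _ ≤ (1 - ν) * c ^ 2 * σ := by gcongr
          _ = c ^ 2 * ((1 - ν) * σ) := by ring
          _ ≤ _ := by
            gcongr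
            exact hcg k
      exact (Real.le_log_iff_exp_le ((Real.exp_pos _).trans_le hexp)).2 hexp
    change potential (update _ _ _) ≤ _
    linarith
  have hsum : ∀ j : ℕ, potential (hessInv f x H₀ (N + 1 + j)) ≤
      potential (hessInv f x H₀ (N + 1)) - j := by
    intro j
    induction j with
    | zero => simp
    | succ j ih =>
      have := hdecr (N + 1 + j) (by omega)
      push_cast
      rw [← add_assoc]
      linarith
  obtain ⟨j, hj⟩ := exists_nat_gt (potential (hessInv f x H₀ (N + 1)))
  linarith [hsum j, potential_nonneg (hpd (N + 1 + j))]

end BFGS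

theorem theorem3 {n : ℕ} (U : Set (EuclideanSpace ℝ (Fin n))) (hUo : IsOpen U)
    (hUc : Convex ℝ U) (f : EuclideanSpace ℝ (Fin n) → ℝ) (hf : ConvexOn ℝ U f)
    (x : ℕ → EuclideanSpace ℝ (Fin n)) (hxU : ∀ k, x k ∈ U) (hx : BFGS.IsBFGSSequence f x)
    (hlev : IsCompact {z ∈ U | f z ≤ f (x 0)}) :
    (ContDiffOn ℝ 2 f U → BFGS.SmoothConvexAbove U f (x 0)) ∧
    (BFGS.SmoothConvexAbove U f (x 0) →
      IsLeast (f '' U) (sInf (f '' U)) ∧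
      Tendsto (fun k => f (x k)) atTop (𝓝 (sInf (f '' U)))) := by
  refine ⟨fun h2 δ _ => ⟨U, f, hUo, hUc, subset_rfl, fun z hz => hz.1, h2, hf,
    fun _ _ _ _ => rfl⟩, fun hsm => ?_⟩
  obtain ⟨hdg, μ, ν, H₀, hμ, -, hν, hH₀, hk⟩ := hx
  obtain ⟨z, hzU, hzmin⟩ :=
    BFGS.exists_isMinOn_of_isCompact_sublevel (hf.continuousOn hUo) (hxU 0) hlev
  have hleast : IsLeast (f '' U) (f z) :=
    ⟨⟨z, hzU, rfl⟩, by rintro _ ⟨w, hw, rfl⟩; exact hzmin w hw⟩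
  have hleast' : IsLeast (f '' U) (sInf (f '' U)) := hleast.csInf_eq.symm ▸ hleast
  have hpd := BFGS.hessInv_posDef hν hH₀ (fun k => (hdg k).2) (fun k => (hk k).1)
    (fun k => (hk k).2.2)
  have hneg : ∀ k, inner ℝ (gradient f (x k)) (x (k + 1) - x k) < 0 := fun k => by
    obtain ⟨t, ht, hst⟩ := (hk k).1
    exact (BFGS.inner_neg_of_step (hpd k) (hdg k).2 ht hst).2
  have hanti : Antitone fun k => f (x k) :=
    antitone_nat_of_succ_le fun k => by nlinarith [(hk k).2.1, hneg k]
  refine ⟨hleast', Metric.tendsto_atTop.2 fun ε hε => ?_⟩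
  obtain ⟨N, hN⟩ := BFGS.exists_lt_of_isBFGSSequence hUo hf hxU (fun k => (hdg k).1)
    (fun k => (hdg k).2) hlev hsm hμ hν hpd
    (fun k => by
      obtain ⟨t, ht, hst⟩ := (hk k).1
      exact ⟨t, (BFGS.inner_neg_of_step (hpd k) (hdg k).2 ht hst).1, hst⟩)
    hneg (fun k => (hk k).2.1) (fun k => (hk k).2.2) hε
  refine ⟨N, fun k hNk => ?_⟩
  have h1 : sInf (f '' U) ≤ f (x k) := hleast'.2 ⟨x k, hxU k, rfl⟩
  have h2 : f (x k) ≤ f (x N) := hanti hNk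
  rw [Real.dist_eq, abs_lt]
  constructor <;> linarith
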